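/- Let $\mathrm{cov}(\mathbf K)$ be the least cardinality of a family of meager sets covering the Baire space ${}^\omega\omega$. (1) For every ordinal $\alpha$ with $1\le\alpha<\omega_1$ there is a Borel subset of ${}^\omega\omega$ which cannot be expressed as the union of fewer than $\mathrm{cov}(\mathbf K)$ many $\boldsymbol\Pi^0_\alpha$ sets. (2) Concretely, let $\mathcal T$ be the space of trees on $\omega$ (sets of finite sequences of natural numbers closed under initial segments), with the topology inherited from the Cantor space of all subsets of ${}^{<\omega}\omega$. For $T\in\mathcal T$ and $s\in T$, let $\mathrm{rk}_T(s)$ be the least ordinal greater than $\mathrm{rk}_T(s^\frown n)$ for all $n$ with $s^\frown n\in T$ if $T$ is well-founded below $s$, and $\mathrm{rk}_T(s)=\infty$ otherwise. For $\beta<\omega_1$ let $R_\beta$ be the set of trees $T\in\mathcal T$ such that the empty sequence is in $T$, each finite sequence $s$ has either all or none of its immediate successors $s^\frown n$ in $T$, and each $s\in T$ has $\mathrm{rk}_T(s)=\infty$ or $\mathrm{rk}_T(s)<\beta$ (equivalently, no node of $T$ has rank exactly $\beta$). If $1\le\alpha$ and $\omega\cdot\alpha\le\beta<\omega_1$, then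 $R_\beta$ is a Borel subset of $\mathcal T$ which is not the union of fewer than $\mathrm{cov}(\mathbf K)$ many $\boldsymbol\Pi^0_\alpha$ subsets of $\mathcal T$. -/

import Mathlib

namespace SternThm

/-- The pointclass `Σ⁰_α` of a topological space, for `α ≥ 1`: the `Σ⁰_1` sets are the open sets,
and for `α > 1` the `Σ⁰_α` sets are the countable unions of sets `A n`, where `A n` is `Π⁰_(β n)`
(its complement is `Σ⁰_(β n)`) for some `1 ≤ β n < α`. -/
inductive IsSigma {X : Type} [TopologicalSpace X] : Ordinal.{0} → Set X → Prop
  | of_isOpen (U : Set X) (hU : IsOpen U) : IsSigma 1 U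
  | iUnion (α : Ordinal.{0}) (hα : 1 < α) (A : ℕ → Set X) (β : ℕ → Ordinal.{0})
      (hβ : ∀ n, 1 ≤ β n) (hβα : ∀ n, β n < α) (hA : ∀ n, IsSigma (β n) (A n)ᶜ) :
      IsSigma α (⋃ n, A n)

/-- The pointclass `Π⁰_α`: complements of `Σ⁰_α` sets. -/
def IsPi {X : Type} [TopologicalSpace X] (α : Ordinal.{0}) (A : Set X) : Prop :=
  IsSigma α Aᶜ

/-- `cov(meager)`: the least cardinality of a family of meager sets covering the Baire space
`ℕ → ℕ` (product of discrete topologies). -/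
noncomputable def covMeager : Cardinal.{0} :=
  sInf {κ | ∃ S : Set (Set (ℕ → ℕ)), (∀ A ∈ S, IsMeagre A) ∧ ⋃₀ S = Set.univ ∧ Cardinal.mk S = κ}

/-- `B` is the union of fewer than `cov(meager)` many `Π⁰_α` sets. -/
def IsSmallUnionOfPi {X : Type} [TopologicalSpace X] (α : Ordinal.{0}) (B : Set X) : Prop :=
  ∃ S : Set (Set X), Cardinal.mk S < covMeager ∧ (∀ A ∈ S, IsPi α A) ∧ ⋃₀ S = B

/-- The space of trees on `ℕ`: sets of finite sequences closed under initial segments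
(the empty tree is included). -/
def Tree : Type := Descriptive.tree ℕ

/-- The node set of a tree. -/
def Tree.nodes (T : Tree) : Set (List ℕ) := Subtype.val T

open Classical in
/-- The indicator function of the node set. -/
noncomputable def Tree.indicator (T : Tree) : List ℕ → Bool := fun s => decide (s ∈ T.nodes)

/-- The Cantor topology: the space of trees is a subspace of the power set `2 ^ (List ℕ)`, with the
product topology of the discrete two-point space. -/
noncomputable instance Tree.instTopologicalSpace : TopologicalSpace Tree :=
  TopologicalSpace.induced Tree.indicator inferInstance

/-- `T.Child t s`: the sequence `t` is an immediate successor of `s`, and `t` is in `T`. -/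
def Tree.Child (T : Tree) (t s : List ℕ) : Prop := t ∈ T.nodes ∧ ∃ n : ℕ, t = s ++ [n]

open Classical in
/-- The rank of a node `s` of `T`: if `T` is well-founded below `s`, it is the least ordinal greater
than the ranks of all immediate successors of `s` in `T`; otherwise it is `∞`. -/
noncomputable def Tree.rank (T : Tree) (s : List ℕ) : WithTop Ordinal.{0} :=
  if h : Acc T.Child s then (h.rank : Ordinal.{0}) else ⊤

/-- Trees that contain the null sequence and in which every sequence has either all or none of
its immediate successors. -/
def Tree.IsGood (T : Tree) : Prop :=
  [] ∈ T.nodes ∧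
    ∀ s : List ℕ, (∀ n : ℕ, s ++ [n] ∈ T.nodes) ∨ (∀ n : ℕ, s ++ [n] ∉ T.nodes)

/-- `R β`: the good trees all of whose nodes have rank either `∞` or less than `β`. -/
def R (β : Ordinal.{0}) : Set Tree :=
  {T | T.IsGood ∧ ∀ s ∈ T.nodes, T.rank s = ⊤ ∨ T.rank s < (β : WithTop Ordinal.{0})}

end SternThm

namespace SternThm

open Set PiNat Encodable Topology

/-! This is Steel forcing with tagged trees, recast as Baire category. A real `x` codes a tagging of
all finite sequences by ordinals below `δ` or `∞`, and the tagging determines a tree. For comeagre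
many `x` the tags are the ranks of the nodes, so with `δ = β` the coded tree lies in `R β`.

The carrying lemma is `IsSigma.isMeagre_retag`: whether the preimage of a `Σ⁰_α` set is meagre below
a finite condition depends only on the condition's tags below `ω * α`. Its combinatorial core is
`exists_agreeUpTo`, in which each drop by one Borel level costs `ω`.

If `R β` were a union of fewer than `cov(meager)` many `Π⁰_α` sets, one of them, `A`, would have a
non-meagre preimage, hence one comeagre below some condition. Extend that condition by a fresh child
of the root tagged `∞`, and retag the child `β`, now allowing tags up to `β`. As `ω * α ≤ β`, `A` is
still comeagre below the new condition, but generic trees there have a node of rank exactly `β`, so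
they are not in `R β`.

The Baire space inherits the result because the space of trees is a continuous retract of it. -/

/-! ### Taggings coded by reals. -/

/-- Tags of nodes: ordinals or `∞`. -/
abbrev Tag : Type 1 := WithTop Ordinal.{0}

/-- A node tagged `a` may have a child tagged `b`, where all tags other than `∞` are below `δ`.
The tag `0` is repeated along the sequences that extend a leaf. -/
def LegalTag (δ : Ordinal.{0}) (a b : Tag) : Prop :=
  (b < δ ∨ b = ⊤) ∧ (b < a ∨ (a = ⊤ ∧ b = ⊤) ∨ (a = 0 ∧ b = 0))

/-- For every tag `a`, the sequence `e a` enumerates the tags which a child of a node tagged `a`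
may have. -/
def IsTagEnum (δ : Ordinal.{0}) (e : Tag → ℕ → Tag) : Prop :=
  ∀ a, range (e a) = {b | LegalTag δ a b}

theorem legalTag_zero {δ : Ordinal.{0}} (hδ : 0 < δ) (a : Tag) : LegalTag δ a 0 := by
  refine ⟨Or.inl (by exact_mod_cast hδ), ?_⟩
  rcases eq_or_ne a 0 with h | h
  · exact Or.inr (Or.inr ⟨h, rfl⟩)
  · exact Or.inl (pos_iff_ne_zero.2 h)

theorem countable_Iio_of_lt_omega_one {δ : Ordinal.{0}} (hδ : δ < Ordinal.omega 1) :
    (Iio δ).Countable := by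
  rw [← Cardinal.le_aleph0_iff_set_countable, Cardinal.mk_Iio_ordinal]
  have : δ.card ≤ Cardinal.aleph0 := by
    rw [← Cardinal.ord_aleph, Cardinal.lt_ord] at hδ
    rw [← Cardinal.succ_aleph0] at hδ
    exact Order.lt_succ_iff.1 hδ
  simpa [← Ordinal.lift_card] using this

theorem exists_isTagEnum {δ : Ordinal.{0}} (h0 : 0 < δ) (hδ : δ < Ordinal.omega 1) :
    ∃ e, IsTagEnum δ e := by
  have hc : ∀ a, {b | LegalTag δ a b}.Countable := by
    intro a
    refine (((countable_Iio_of_lt_omega_one hδ).image ((↑) : Ordinal → Tag)).union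
      (countable_singleton ⊤)).mono ?_
    rintro b ⟨hb | hb, -⟩
    · left
      induction b using WithTop.recTopCoe with
      | top => simp at hb
      | coe b => exact ⟨b, by exact_mod_cast hb, rfl⟩
    · right; exact hb
  choose e he using fun a => (hc a).exists_eq_range ⟨0, legalTag_zero h0 a⟩
  exact ⟨e, fun a => (he a).symm⟩

/-- The tagging of finite sequences coded by a real `x`. Sequences are written with their last
entry first. -/
def tag (e : Tag → ℕ → Tag) (x : ℕ → ℕ) : List ℕ → Tag
  | [] => ⊤
  | k :: u => e (tag e x u) (x (encode (k :: u)))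

/-- Because parents have smaller codes, the first `n` values of a real fix all tags at sequences
with code below `n`; a cylinder thus acts as a finite condition. -/
theorem encode_lt_encode_cons (k : ℕ) (u : List ℕ) : encode u < encode (k :: u) := by
  rw [encode_list_cons]
  exact Nat.lt_succ_of_le (Nat.right_le_pair _ _)

theorem legalTag_tag {δ : Ordinal.{0}} {e : Tag → ℕ → Tag} (he : IsTagEnum δ e) (x : ℕ → ℕ)
    (k : ℕ) (u : List ℕ) : LegalTag δ (tag e x u) (tag e x (k :: u)) := by
  have : tag e x (k :: u) ∈ range (e (tag e x u)) := ⟨_, rfl⟩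
  rwa [he] at this

theorem tag_congr (e : Tag → ℕ → Tag) {x y : ℕ → ℕ} {n : ℕ} (h : y ∈ cylinder x n) :
    ∀ u : List ℕ, encode u < n → tag e y u = tag e x u
  | [], _ => rfl
  | k :: u, hu => by
    rw [tag, tag, tag_congr e h u ((encode_lt_encode_cons k u).trans hu), h _ hu]

theorem exists_tag_eq {δ : Ordinal.{0}} {e : Tag → ℕ → Tag} (he : IsTagEnum δ e)
    {t : List ℕ → Tag} (t0 : t [] = ⊤) (ht : ∀ u k, LegalTag δ (t u) (t (k :: u)))
    {x : ℕ → ℕ} {n : ℕ} (hx : ∀ u, encode u < n → t u = tag e x u) :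
    ∃ y ∈ cylinder x n, ∀ u, tag e y u = t u := by
  have hex : ∀ u k, ∃ i, e (t u) i = t (k :: u) := fun u k => by
    have : t (k :: u) ∈ range (e (t u)) := by rw [he]; exact ht u k
    exact this
  choose c hc using hex
  let y : ℕ → ℕ := fun i => if i < n then x i else
    match (decode i : Option (List ℕ)) with
    | some (k :: u) => c u k
    | _ => 0
  have hy : y ∈ cylinder x n := fun i hi => by simp [y, hi]
  refine ⟨y, hy, fun u => ?_⟩
  induction u with
  | nil => rw [t0]; rfl
  | cons k u ih =>
    by_cases hu : encode (k :: u) < n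
    · rw [tag_congr e hy _ hu, hx _ hu]
    · rw [tag, ih]
      have : y (encode (k :: u)) = c u k := by
        simp only [y, if_neg hu, encodek]
      rw [this, hc]

/-! ### Agreement of tags and copying of extensions. -/

/-- Two tags agree up to `γ` if they are equal or both at least `γ`. -/
def AgreeUpTo (γ : Ordinal.{0}) (a b : Tag) : Prop := (a < γ ∨ b < γ) → a = b

theorem AgreeUpTo.symm {γ : Ordinal.{0}} {a b : Tag} (h : AgreeUpTo γ a b) : AgreeUpTo γ b a :=
  fun h' => (h h'.symm).symm

theorem AgreeUpTo.mono {γ γ' : Ordinal.{0}} (hγ : γ ≤ γ') {a b : Tag} (h : AgreeUpTo γ' a b) :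
    AgreeUpTo γ a b := by
  have : (γ : Tag) ≤ γ' := by exact_mod_cast hγ
  exact fun h' => h (h'.imp (·.trans_le this) (·.trans_le this))

theorem agreeUpTo_min {γ η : Ordinal.{0}} (h : γ ≤ η) (b : Tag) :
    AgreeUpTo γ (min b (η : Tag)) b := by
  have h' : (γ : Tag) ≤ η := by exact_mod_cast h
  intro hb
  rw [min_eq_left_iff]
  rcases hb with hb | hb
  · rcases min_lt_iff.1 hb with hb | hb
    · exact (hb.trans_le h').le
    · exact absurd hb h'.not_gt
  · exact (hb.trans_le h').le

/-- New child of an old node: if `a` is below `γ + ω` then `a = a'` and truncating `b'` does no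
harm; otherwise every cap `γ + j` is below `a`. -/
theorem LegalTag.min_of_agree {δ δ' γ : Ordinal.{0}} {a a' b' : Tag} {j : ℕ}
    (hδ : γ + Ordinal.omega0 ≤ δ) (h : LegalTag δ' a' b')
    (ha : AgreeUpTo (γ + Ordinal.omega0) a a') :
    LegalTag δ a (min b' ((γ + j : Ordinal.{0}) : Tag)) := by
  have hj : ((γ + j : Ordinal.{0}) : Tag) < ((γ + Ordinal.omega0 : Ordinal.{0}) : Tag) := by
    exact_mod_cast (add_lt_add_iff_left γ).2 (Ordinal.natCast_lt_omega0 j)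
  have hδ' : ((γ + Ordinal.omega0 : Ordinal.{0}) : Tag) ≤ δ := by exact_mod_cast hδ
  refine ⟨Or.inl ((min_le_right _ _).trans_lt (hj.trans_le hδ')), ?_⟩
  by_cases hlt : a < ((γ + Ordinal.omega0 : Ordinal.{0}) : Tag)
  · obtain rfl := ha (Or.inl hlt)
    rcases h.2 with h | ⟨h, -⟩ | ⟨h, h'⟩
    · exact Or.inl ((min_le_left _ _).trans_lt h)
    · exact absurd h (hlt.trans_le le_top).ne
    · exact Or.inr (Or.inr ⟨h, by rw [h']; exact min_eq_left zero_le⟩)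
  · exact Or.inl ((min_le_right _ _).trans_lt (hj.trans_le (not_lt.1 hlt)))

/-- New child of a new node: the cap drops strictly, so even a pair of tags `∞` truncates to a legal
decreasing pair. -/
theorem LegalTag.min_min {δ δ' γ : Ordinal.{0}} {a b : Tag} {i j : ℕ}
    (hδ : γ + Ordinal.omega0 ≤ δ) (h : LegalTag δ' a b) (hij : j < i) :
    LegalTag δ (min a ((γ + i : Ordinal.{0}) : Tag)) (min b ((γ + j : Ordinal.{0}) : Tag)) := by
  have hj : ((γ + j : Ordinal.{0}) : Tag) < ((γ + Ordinal.omega0 : Ordinal.{0}) : Tag) := by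
    exact_mod_cast (add_lt_add_iff_left γ).2 (Ordinal.natCast_lt_omega0 j)
  have hδ' : ((γ + Ordinal.omega0 : Ordinal.{0}) : Tag) ≤ δ := by exact_mod_cast hδ
  have hji : ((γ + j : Ordinal.{0}) : Tag) < ((γ + i : Ordinal.{0}) : Tag) := by
    exact_mod_cast (add_lt_add_iff_left γ).2 (Nat.cast_lt.2 hij)
  refine ⟨Or.inl ((min_le_right _ _).trans_lt (hj.trans_le hδ')), ?_⟩
  rcases h.2 with h | ⟨rfl, rfl⟩ | ⟨rfl, rfl⟩
  · exact Or.inl (lt_min ((min_le_left _ _).trans_lt h) ((min_le_right _ _).trans_lt hji))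
  · exact Or.inl (by simpa using hji)
  · exact Or.inr (Or.inr ⟨min_eq_left zero_le, min_eq_left zero_le⟩)

/-- Extensions of a tagging can be copied to a tagging that agrees with it up to `γ + ω`, with
agreement of the extensions up to `γ`. -/
theorem exists_agreeUpTo {δ δ' γ : Ordinal.{0}} {e e' : Tag → ℕ → Tag} (he : IsTagEnum δ e)
    (he' : IsTagEnum δ' e') (hδ : γ + Ordinal.omega0 ≤ δ) {x x' y' : ℕ → ℕ} {n : ℕ}
    (h : ∀ u, encode u < n → AgreeUpTo (γ + Ordinal.omega0) (tag e x u) (tag e' x' u))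
    (hy' : y' ∈ cylinder x' n) (m : ℕ) :
    ∃ y ∈ cylinder x n, ∀ u, encode u < m → AgreeUpTo γ (tag e y u) (tag e' y' u) := by
  -- Old nodes keep their tags. New nodes with code below `m` copy `y'` capped at `γ + (m - code)`:
  -- codes grow from parent to child, so the cap decreases, yet stays at least `γ`. Beyond `m` the
  -- always legal tag `0` is used. The root counts as old even when `n = 0`.
  let t : List ℕ → Tag := fun u => if encode u < n ∨ u = [] then tag e x u else
    if encode u < m then min (tag e' y' u) ((γ + (m - encode u : ℕ) : Ordinal.{0}) : Tag) else 0
  have ht1 : ∀ u, encode u < n → t u = tag e x u := fun u hu => by simp [t, hu]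
  have hagr : ∀ u, encode u < n ∨ u = [] →
      AgreeUpTo (γ + Ordinal.omega0) (tag e x u) (tag e' y' u) := by
    rintro u (hu | rfl)
    · rw [tag_congr e' hy' u hu]; exact h u hu
    · exact fun _ => rfl
  have h0 : 0 < δ := (Ordinal.omega0_pos.trans_le (le_add_self)).trans_le hδ
  have hleg : ∀ u k, LegalTag δ (t u) (t (k :: u)) := by
    intro u k
    have huk := encode_lt_encode_cons k u
    by_cases h1 : encode (k :: u) < n
    · rw [ht1 _ h1, ht1 _ (huk.trans h1)]
      exact legalTag_tag he x k u
    by_cases h2 : encode (k :: u) < m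
    · have e1 : t (k :: u) =
          min (tag e' y' (k :: u)) ((γ + (m - encode (k :: u) : ℕ) : Ordinal.{0}) : Tag) := by
        simp only [t, h1, h2, false_or, if_true, reduceCtorEq, if_false]
      rw [e1]
      by_cases h3 : encode u < n ∨ u = []
      · have e2 : t u = tag e x u := if_pos h3
        rw [e2]
        exact (legalTag_tag he' y' k u).min_of_agree hδ (hagr u h3)
      · have e2 : t u = min (tag e' y' u) ((γ + (m - encode u : ℕ) : Ordinal.{0}) : Tag) := by
          simp only [t, if_neg h3, if_pos (huk.trans h2)]
        rw [e2]
        exact (legalTag_tag he' y' k u).min_min hδ (by omega)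
    · have e1 : t (k :: u) = 0 := by
        simp only [t, h1, h2, false_or, reduceCtorEq, if_false]
      rw [e1]
      exact legalTag_zero h0 _
  obtain ⟨y, hy, hty⟩ := exists_tag_eq he (t := t) (by simp [t, tag]) hleg ht1
  refine ⟨y, hy, fun u hu => ?_⟩
  rw [hty]
  by_cases h3 : encode u < n ∨ u = []
  · have e2 : t u = tag e x u := if_pos h3
    rw [e2]
    exact (hagr u h3).mono le_self_add
  · have e2 : t u = min (tag e' y' u) ((γ + (m - encode u : ℕ) : Ordinal.{0}) : Tag) := by
      simp only [t, if_neg h3, if_pos hu]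
    rw [e2]
    exact agreeUpTo_min le_self_add _

/-! ### The tree of a tagging. -/

/-- The tree coded by `x`: the null sequence, and the sequences whose immediate predecessor
does not have the tag `0`. -/
def treeNodes (e : Tag → ℕ → Tag) (x : ℕ → ℕ) : Set (List ℕ) :=
  {s | ∀ k u, s.reverse = k :: u → tag e x u ≠ 0}

theorem nil_mem_treeNodes (e : Tag → ℕ → Tag) (x : ℕ → ℕ) : [] ∈ treeNodes e x := by
  intro k u h
  simp at h

theorem append_mem_treeNodes {e : Tag → ℕ → Tag} {x : ℕ → ℕ} {s : List ℕ} {k : ℕ} :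
    s ++ [k] ∈ treeNodes e x ↔ tag e x s.reverse ≠ 0 := by
  simp only [treeNodes, mem_ofPred_eq, List.reverse_append, List.reverse_cons, List.reverse_nil,
    List.nil_append, List.singleton_append, List.cons.injEq]
  exact ⟨fun h => h k _ ⟨rfl, rfl⟩, by rintro h _ _ ⟨-, rfl⟩; exact h⟩

theorem tag_ne_zero_of_cons {δ : Ordinal.{0}} {e : Tag → ℕ → Tag} (he : IsTagEnum δ e)
    {x : ℕ → ℕ} {k : ℕ} {u : List ℕ} (h : tag e x (k :: u) ≠ 0) : tag e x u ≠ 0 := by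
  intro h0
  rcases (legalTag_tag he x k u).2 with h' | ⟨h', -⟩ | ⟨-, h'⟩
  · rw [h0] at h'; exact not_lt_zero h'
  · rw [h0] at h'; exact WithTop.zero_ne_top h'
  · exact h h'

theorem mem_treeNodes_of_append {δ : Ordinal.{0}} {e : Tag → ℕ → Tag} (he : IsTagEnum δ e)
    {x : ℕ → ℕ} {s : List ℕ} {k : ℕ} (h : s ++ [k] ∈ treeNodes e x) : s ∈ treeNodes e x := by
  rw [append_mem_treeNodes] at h
  intro i u hu
  rw [hu] at h
  exact tag_ne_zero_of_cons he h

/-- The tree coded by `x`, as a point of the space of trees. -/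
def codedTree {δ : Ordinal.{0}} {e : Tag → ℕ → Tag} (he : IsTagEnum δ e) (x : ℕ → ℕ) : Tree :=
  ⟨treeNodes e x, fun _ _ h => mem_treeNodes_of_append he h⟩

theorem mem_treeNodes_iff_of_agree {e e' : Tag → ℕ → Tag} {x y : ℕ → ℕ} {s : List ℕ} {m : ℕ}
    (hs : encode s.reverse < m)
    (h : ∀ u, encode u < m → AgreeUpTo 1 (tag e x u) (tag e' y u)) :
    s ∈ treeNodes e x ↔ s ∈ treeNodes e' y := by
  have key : ∀ k u, s.reverse = k :: u → (tag e x u = 0 ↔ tag e' y u = 0) := by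
    intro k u hu
    rw [hu] at hs
    have := h u ((encode_lt_encode_cons k u).trans hs)
    have h1 : (0 : Tag) < ((1 : Ordinal.{0}) : Tag) := by exact_mod_cast zero_lt_one
    constructor
    · intro h0
      rw [← this (Or.inl (by rw [h0]; exact h1)), h0]
    · intro h0
      rw [this (Or.inr (by rw [h0]; exact h1)), h0]
  exact forall₂_congr fun k u => forall_congr' fun hu => (key k u hu).not

/-- A neighbourhood of a tree contains all trees which agree with it on some finite set of
sequences. -/
theorem exists_bound_of_isOpen {B : Set Tree} (hB : IsOpen B) {T : Tree} (hT : T ∈ B) :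
    ∃ m : ℕ, ∀ T' : Tree,
      (∀ s : List ℕ, encode s.reverse < m → (s ∈ T'.nodes ↔ s ∈ T.nodes)) → T' ∈ B := by
  obtain ⟨V, hV, rfl⟩ := isOpen_induced_iff.1 hB
  obtain ⟨F, u, hu, hF⟩ := isOpen_pi_iff.1 hV _ hT
  refine ⟨F.sup (fun s => encode s.reverse) + 1, fun T' h => hF ?_⟩
  intro s hs
  have h1 := h s (Nat.lt_succ_of_le (Finset.le_sup (f := fun s : List ℕ => encode s.reverse) hs))
  have : T'.indicator s = T.indicator s := by simp [Tree.indicator, h1]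
  rw [this]
  exact (hu s hs).2

theorem isOpen_setOf_of_cylinder {A : Set (ℕ → ℕ)} (h : ∀ x ∈ A, ∃ n, cylinder x n ⊆ A) :
    IsOpen A := by
  rw [isOpen_iff_mem_nhds]
  intro x hx
  obtain ⟨n, hn⟩ := h x hx
  exact Filter.mem_of_superset ((isOpen_cylinder _ x n).mem_nhds (self_mem_cylinder x n)) hn

theorem exists_cylinder_subset {U : Set (ℕ → ℕ)} (hU : IsOpen U) {x : ℕ → ℕ} (hx : x ∈ U) :
    ∃ n, cylinder x n ⊆ U := by
  obtain ⟨_, ⟨y, n, rfl⟩, hxy, h⟩ :=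
    (isTopologicalBasis_cylinders (fun _ => ℕ)).exists_subset_of_mem_open hx hU
  exact ⟨n, by rwa [mem_cylinder_iff_eq.1 hxy]⟩

theorem continuous_codedTree {δ : Ordinal.{0}} {e : Tag → ℕ → Tag} (he : IsTagEnum δ e) :
    Continuous (codedTree he) := by
  rw [continuous_def]
  refine fun B hB => isOpen_setOf_of_cylinder fun x hx => ?_
  obtain ⟨m, hm⟩ := exists_bound_of_isOpen hB hx
  refine ⟨m, fun y hy => hm _ fun s hs => ?_⟩
  exact mem_treeNodes_iff_of_agree hs fun u hu _ => tag_congr e hy u hu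

/-! ### Borel sets, category and retagging. -/

theorem IsSigma.measurableSet {X : Type} [TopologicalSpace X] {α : Ordinal.{0}} {B : Set X}
    (h : IsSigma α B) : @MeasurableSet X (borel X) B := by
  borelize X
  induction h with
  | of_isOpen U hU => exact hU.measurableSet
  | iUnion α hα A β hβ hβα hA ih => exact MeasurableSet.iUnion fun n => (ih n).of_compl

theorem IsSigma.preimage {X Y : Type} [TopologicalSpace X] [TopologicalSpace Y] {f : X → Y}
    (hf : Continuous f) {α : Ordinal.{0}} {B : Set Y} (h : IsSigma α B) :
    IsSigma α (f ⁻¹' B) := by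
  induction h with
  | of_isOpen U hU => exact .of_isOpen _ (hU.preimage hf)
  | iUnion α hα A β hβ hβα hA ih =>
    rw [preimage_iUnion]
    exact .iUnion α hα _ β hβ hβα ih

theorem not_isMeagre_of_isOpen {U : Set (ℕ → ℕ)} (hU : IsOpen U) (hne : U.Nonempty) :
    ¬ IsMeagre U := fun h => by
  obtain ⟨x, hx⟩ := hne
  obtain ⟨y, hy, hy'⟩ := (dense_of_mem_residual h).inter_open_nonempty U hU ⟨x, hx⟩
  exact hy' hy

theorem not_isMeagre_cylinder (x : ℕ → ℕ) (n : ℕ) : ¬ IsMeagre (cylinder x n) :=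
  not_isMeagre_of_isOpen (isOpen_cylinder _ x n) ⟨x, self_mem_cylinder x n⟩

/-- A non-meagre Borel set is comeagre in some basic open set, which can be chosen inside a given
open set in which it is not meagre. -/
theorem exists_cylinder_diff_isMeagre {U A : Set (ℕ → ℕ)} (hU : IsOpen U)
    (hA : @MeasurableSet _ (borel (ℕ → ℕ)) A) (h : ¬ IsMeagre (U ∩ A)) :
    ∃ y ∈ U, ∃ m, cylinder y m ⊆ U ∧ IsMeagre (cylinder y m ∩ Aᶜ) := by
  borelize (ℕ → ℕ)
  obtain ⟨V, hV, hAV⟩ := hA.residualEq_isOpen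
  have hne : (U ∩ V).Nonempty := by
    by_contra hne
    rw [not_nonempty_iff_eq_empty] at hne
    refine h ?_
    filter_upwards [Filter.eventuallyEq_set.1 hAV] with x hx hxA
    exact (hne ▸ (⟨hxA.1, hx.1 hxA.2⟩ : x ∈ U ∩ V) : x ∈ (∅ : Set (ℕ → ℕ)))
  obtain ⟨y, hy⟩ := hne
  obtain ⟨m, hm⟩ := exists_cylinder_subset (hU.inter hV) hy
  refine ⟨y, hy.1, m, fun z hz => (hm hz).1, ?_⟩
  filter_upwards [Filter.eventuallyEq_set.1 hAV] with x hx hxA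
  exact hxA.2 (hx.2 (hm hxA.1).2)

/-- The retagging lemma: category of a `Σ⁰_α` set of trees below a condition depends only on the
tags less than `ω * α` of that condition. -/
theorem IsSigma.isMeagre_retag {α : Ordinal.{0}} {B : Set Tree} (hB : IsSigma α B)
    {δ δ' : Ordinal.{0}} {e e' : Tag → ℕ → Tag} (he : IsTagEnum δ e) (he' : IsTagEnum δ' e')
    (hδ : Ordinal.omega0 * α ≤ δ) (hδ' : Ordinal.omega0 * α ≤ δ') {x x' : ℕ → ℕ} {n : ℕ}
    (h : ∀ u, encode u < n → AgreeUpTo (Ordinal.omega0 * α) (tag e x u) (tag e' x' u))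
    (hm : IsMeagre (cylinder x n ∩ codedTree he ⁻¹' B)) :
    IsMeagre (cylinder x' n ∩ codedTree he' ⁻¹' B) := by
  induction hB generalizing δ δ' e e' x x' n with
  | of_isOpen U hU =>
    suffices hempty : cylinder x' n ∩ codedTree he' ⁻¹' U = ∅ by
      rw [hempty]; exact IsMeagre.empty
    rw [← not_nonempty_iff_eq_empty]
    rintro ⟨y', hy', hyU⟩
    obtain ⟨m, hmU⟩ := exists_bound_of_isOpen hU hyU
    -- Tree membership only depends on which tags are `0`, that is, on agreement up to `1`; `1 + ω =
    -- ω` leaves room for one copying.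
    have hω : (1 : Ordinal.{0}) + Ordinal.omega0 = Ordinal.omega0 * 1 := by
      rw [Ordinal.one_add_omega0, mul_one]
    rw [← hω] at h hδ
    obtain ⟨y, hy, hagr⟩ := exists_agreeUpTo he he' hδ h hy' m
    refine not_isMeagre_of_isOpen ((isOpen_cylinder _ x n).inter
      (hU.preimage (continuous_codedTree he))) ⟨y, hy, hmU _ fun s hs => ?_⟩ hm
    exact mem_treeNodes_iff_of_agree hs hagr
  | iUnion α hα A β hβ hβα hA ih =>
    rw [preimage_iUnion, inter_iUnion]
    refine isMeagre_iUnion fun k => ?_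
    -- Otherwise `A k` is comeagre below some `y'`. Copy `y'` to an extension `y` of `x`; the
    -- induction hypothesis, used from the primed side to the unprimed one, makes `A k` comeagre
    -- below `y`, against `hm`.
    by_contra hk
    have hmeas : @MeasurableSet _ (borel (ℕ → ℕ)) (codedTree he' ⁻¹' A k) := by
      have := ((hA k).preimage (continuous_codedTree he')).measurableSet
      rw [preimage_compl] at this
      exact this.of_compl
    obtain ⟨y', hy', m, hsub, hym⟩ :=
      exists_cylinder_diff_isMeagre (isOpen_cylinder _ x' n) hmeas hk
    have hω : Ordinal.omega0 * β k + Ordinal.omega0 ≤ Ordinal.omega0 * α := by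
      rw [← Ordinal.mul_succ]
      exact mul_le_mul_right (Order.succ_le_of_lt (hβα k)) _
    have hω' : Ordinal.omega0 * β k ≤ Ordinal.omega0 * α := le_self_add.trans hω
    obtain ⟨y, hy, hagr⟩ := exists_agreeUpTo he he' (hω.trans hδ)
      (fun u hu => (h u hu).mono hω) hy' (max n m)
    have hym' : IsMeagre (cylinder y m ∩ codedTree he ⁻¹' (A k)ᶜ) :=
      ih k he' he (hω'.trans hδ') (hω'.trans hδ)
        (fun u hu => (hagr u (lt_max_of_lt_right hu)).symm) hym
    refine not_isMeagre_cylinder y (max n m) ((hm.union hym').mono fun z hz => ?_)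
    have hz1 : z ∈ cylinder x n := by
      rw [← mem_cylinder_iff_eq.1 hy]
      exact cylinder_anti _ (le_max_left n m) hz
    have hz2 : z ∈ cylinder y m := cylinder_anti _ (le_max_right n m) hz
    by_cases hzA : codedTree he z ∈ A k
    · exact Or.inl ⟨hz1, mem_iUnion.2 ⟨k, hzA⟩⟩
    · exact Or.inr ⟨hz2, hzA⟩

/-! ### Ranks, and `R β` is Borel. -/

theorem Tree.rank_eq_top_iff {T : Tree} {s : List ℕ} : T.rank s = ⊤ ↔ ¬ Acc T.Child s := by
  unfold Tree.rank
  split_ifs with h <;> simp [h]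

theorem Tree.rank_lt_coe_iff {T : Tree} {s : List ℕ} {γ : Ordinal.{0}} :
    T.rank s < γ ↔ ∃ ξ < γ, ∀ n : ℕ, s ++ [n] ∈ T.nodes → T.rank (s ++ [n]) < ξ := by
  constructor
  · intro h
    have hacc : Acc T.Child s := by
      by_contra hn
      rw [Tree.rank_eq_top_iff.2 hn] at h
      exact not_top_lt h
    have hr : T.rank s = (hacc.rank : Ordinal.{0}) := dif_pos hacc
    refine ⟨hacc.rank, by rw [hr] at h; exact_mod_cast h, fun n hn => ?_⟩
    have hc : T.Child (s ++ [n]) s := ⟨hn, n, rfl⟩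
    have hr' : T.rank (s ++ [n]) = ((hacc.inv hc).rank : Ordinal.{0}) := dif_pos _
    rw [hr']
    exact_mod_cast hacc.rank_lt_of_rel hc
  · rintro ⟨ξ, hξ, h⟩
    have hacc : Acc T.Child s := by
      refine ⟨_, ?_⟩
      rintro _ ⟨hn, n, rfl⟩
      by_contra hna
      have := h n hn
      rw [Tree.rank_eq_top_iff.2 hna] at this
      exact not_top_lt this
    have hr : T.rank s = (hacc.rank : Ordinal.{0}) := dif_pos hacc
    rw [hr]
    refine WithTop.coe_lt_coe.2 (lt_of_le_of_lt ?_ hξ)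
    rw [hacc.rank_eq]
    refine Ordinal.iSup_le ?_
    rintro ⟨_, hn, n, rfl⟩
    have h1 := h n hn
    have hr' : T.rank (s ++ [n]) = ((hacc.inv ⟨hn, n, rfl⟩).rank : Ordinal.{0}) := dif_pos _
    rw [hr'] at h1
    exact Order.succ_le_of_lt (WithTop.coe_lt_coe.1 h1)

theorem Tree.indicator_eq_true {T : Tree} {s : List ℕ} : T.indicator s = true ↔ s ∈ T.nodes := by
  simp [Tree.indicator]

theorem continuous_indicator : Continuous Tree.indicator := continuous_induced_dom

theorem isOpen_setOf_mem_nodes (s : List ℕ) : IsOpen {T : Tree | s ∈ T.nodes} := by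
  have hc : Continuous fun T : Tree => T.indicator s :=
    (continuous_apply s).comp continuous_indicator
  have : {T : Tree | s ∈ T.nodes} = (fun T : Tree => T.indicator s) ⁻¹' {true} := by
    ext T; exact Tree.indicator_eq_true.symm
  rw [this]
  exact (isOpen_discrete _).preimage hc

theorem measurableSet_setOf_rank_lt {γ : Ordinal.{0}} (hγ : γ < Ordinal.omega 1) (s : List ℕ) :
    @MeasurableSet Tree (borel Tree) {T | T.rank s < γ} := by
  borelize Tree
  induction γ using WellFoundedLT.induction generalizing s with
  | ind γ ih =>
    have : {T : Tree | T.rank s < γ} =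
        ⋃ ξ ∈ Iio γ, ⋂ n : ℕ, ({T | s ++ [n] ∈ T.nodes}ᶜ ∪ {T | T.rank (s ++ [n]) < (ξ : Tag)}) := by
      ext T
      simp only [mem_ofPred_eq, Tree.rank_lt_coe_iff (s := s), mem_iUnion, mem_Iio, mem_iInter,
        mem_union, mem_compl_iff, exists_prop, imp_iff_not_or]
    rw [this]
    refine MeasurableSet.biUnion (countable_Iio_of_lt_omega_one hγ) fun ξ hξ => ?_
    exact MeasurableSet.iInter fun n =>
      (isOpen_setOf_mem_nodes _).measurableSet.compl.union (ih ξ hξ (lt_trans hξ hγ) _)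

/-- If no node has rank exactly `β`, then every node has rank `∞` or less than `β`. -/
theorem rank_eq_top_or_lt {T : Tree} {β : Ordinal.{0}}
    (h : ∀ s ∈ T.nodes, T.rank s < (Order.succ β : Ordinal.{0}) → T.rank s < β) :
    ∀ s ∈ T.nodes, T.rank s = ⊤ ∨ T.rank s < β := by
  intro s hs
  by_cases hacc : Acc T.Child s
  · right
    induction hacc with
    | intro s _ ih =>
      exact h s hs (Tree.rank_lt_coe_iff.2
        ⟨β, Order.lt_succ β, fun n hn => ih _ ⟨hn, n, rfl⟩ hn⟩)
  · exact Or.inl (Tree.rank_eq_top_iff.2 hacc)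

theorem measurableSet_R {β : Ordinal.{0}} (hβ : β < Ordinal.omega 1) :
    @MeasurableSet Tree (borel Tree) (R β) := by
  borelize Tree
  have hs : Order.succ β < Ordinal.omega 1 :=
    (Cardinal.isSuccLimit_omega 1).succ_lt hβ
  have hm : ∀ s, MeasurableSet {T : Tree | s ∈ T.nodes} :=
    fun s => (isOpen_setOf_mem_nodes s).measurableSet
  -- Rank `∞` is not visibly a Borel condition, so "no node has rank exactly `β`" is used instead,
  -- through bounds by `β` and its successor.
  have : R β = ({T : Tree | [] ∈ T.nodes} ∩ ⋂ s : List ℕ,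
      ((⋂ n : ℕ, {T : Tree | s ++ [n] ∈ T.nodes}) ∪ ⋂ n : ℕ, {T : Tree | s ++ [n] ∈ T.nodes}ᶜ)) ∩
      ⋂ s : List ℕ, ({T : Tree | s ∈ T.nodes}ᶜ ∪
        ({T : Tree | T.rank s < (Order.succ β : Ordinal.{0})}ᶜ ∪ {T : Tree | T.rank s < β})) := by
    ext T
    simp only [R, Tree.IsGood, mem_ofPred_eq, mem_inter_iff, mem_iInter, mem_union, mem_compl_iff,
      ← imp_iff_not_or]
    refine and_congr_right fun _ => ⟨fun h s hs hlt => ?_, rank_eq_top_or_lt⟩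
    rcases h s hs with h | h
    · rw [h] at hlt; exact absurd hlt not_top_lt
    · exact h
  rw [this]
  refine ((hm _).inter (MeasurableSet.iInter fun s => ?_)).inter (MeasurableSet.iInter fun s => ?_)
  · exact (MeasurableSet.iInter fun n => hm _).union (MeasurableSet.iInter fun n => (hm _).compl)
  · exact (hm _).compl.union ((measurableSet_setOf_rank_lt hs s).compl.union
      (measurableSet_setOf_rank_lt hβ s))

/-! ### Generic reals: tags are ranks. -/

theorem isGood_codedTree {δ : Ordinal.{0}} {e : Tag → ℕ → Tag} (he : IsTagEnum δ e)
    (x : ℕ → ℕ) : (codedTree he x).IsGood := by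
  refine ⟨nil_mem_treeNodes e x, fun s => ?_⟩
  by_cases h : tag e x s.reverse = 0
  · exact Or.inr fun n hn => append_mem_treeNodes.1 hn h
  · exact Or.inl fun n => append_mem_treeNodes.2 h

/-- Reals for which every possible tag of a child of any given node is realized. -/
def genericReals : Set (ℕ → ℕ) :=
  {x | ∀ (u : List ℕ) (i : ℕ), ∃ k : ℕ, x (encode (k :: u)) = i}

theorem isMeagre_compl_genericReals : IsMeagre genericRealsᶜ := by
  rw [IsMeagre, compl_compl]
  have : genericReals = ⋂ (u : List ℕ) (i : ℕ), {x | ∃ k : ℕ, x (encode (k :: u)) = i} := by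
    ext x; simp [genericReals]
  rw [this]
  refine countable_iInter_mem.2 fun u => countable_iInter_mem.2 fun i => ?_
  refine residual_of_dense_open ?_ ?_
  · rw [ofPred_exists]
    refine isOpen_iUnion fun k => ?_
    exact (isOpen_discrete ({i} : Set ℕ)).preimage
      (continuous_apply (A := fun _ => ℕ) (encode (k :: u)))
  · rw [dense_iff_inter_open]
    rintro U hU ⟨x, hx⟩
    obtain ⟨n, hn⟩ := exists_cylinder_subset hU hx
    have hlt : n ≤ encode (n :: u) := by
      rw [encode_list_cons]
      exact (Nat.left_le_pair n _).trans (Nat.le_succ _)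
    refine ⟨Function.update x (encode (n :: u)) i, hn fun j hj => ?_, n, ?_⟩
    · exact Function.update_of_ne (hj.trans_le hlt).ne _ _
    · exact Function.update_self _ _ _

theorem exists_tag_cons_eq {δ : Ordinal.{0}} {e : Tag → ℕ → Tag} (he : IsTagEnum δ e)
    {x : ℕ → ℕ} (hx : x ∈ genericReals) {u : List ℕ} {b : Tag} (hb : LegalTag δ (tag e x u) b) :
    ∃ k, tag e x (k :: u) = b := by
  have : b ∈ range (e (tag e x u)) := by rw [he]; exact hb
  obtain ⟨i, rfl⟩ := this
  obtain ⟨k, hk⟩ := hx u i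
  exact ⟨k, by rw [tag, hk]⟩

/-- Ordinal tags strictly decrease along the coded tree, so they bound the rank for every real;
genericity is needed only for the lower bound. -/
theorem rank_codedTree_lt_succ {δ : Ordinal.{0}} {e : Tag → ℕ → Tag} (he : IsTagEnum δ e)
    (x : ℕ → ℕ) (γ : Ordinal.{0}) (s : List ℕ) (hs : tag e x s.reverse = γ) :
    (codedTree he x).rank s < (Order.succ γ : Ordinal.{0}) := by
  induction γ using WellFoundedLT.induction generalizing s with
  | ind γ ih =>
    refine Tree.rank_lt_coe_iff.2 ⟨γ, Order.lt_succ γ, fun n hn => ?_⟩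
    have h0 : tag e x s.reverse ≠ 0 := append_mem_treeNodes.1 hn
    have hrev : (s ++ [n]).reverse = n :: s.reverse := by simp
    rcases (legalTag_tag he x n s.reverse).2 with h | ⟨h, -⟩ | ⟨h, -⟩
    · rw [hs] at h
      obtain ⟨b, hb⟩ := WithTop.ne_top_iff_exists.1 (h.trans_le le_top).ne
      rw [← hb] at h
      have hbγ : b < γ := WithTop.coe_lt_coe.1 h
      exact (ih b hbγ (s ++ [n]) (by rw [hrev, hb])).trans_le
        (WithTop.coe_le_coe.2 (Order.succ_le_of_lt hbγ))
    · rw [hs] at h; exact absurd h (WithTop.coe_ne_top)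
    · exact absurd h h0

theorem le_rank_codedTree {δ : Ordinal.{0}} {e : Tag → ℕ → Tag} (he : IsTagEnum δ e)
    {x : ℕ → ℕ} (hx : x ∈ genericReals) (γ : Ordinal.{0}) (s : List ℕ)
    (hs : tag e x s.reverse = γ) (hγ : γ ≤ δ) : γ ≤ (codedTree he x).rank s := by
  rw [← not_lt]
  induction γ using WellFoundedLT.induction generalizing s with
  | ind γ ih =>
    intro h
    obtain ⟨ξ, hξ, h⟩ := Tree.rank_lt_coe_iff.1 h
    have hξ' : (ξ : Tag) < γ := WithTop.coe_lt_coe.2 hξ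
    obtain ⟨k, hk⟩ := exists_tag_cons_eq he hx (u := s.reverse) (b := ξ)
      ⟨Or.inl (WithTop.coe_lt_coe.2 (hξ.trans_le hγ)), Or.inl (by rw [hs]; exact hξ')⟩
    refine ih ξ hξ (s ++ [k]) (by simpa using hk) (hξ.le.trans hγ)
      (h k (append_mem_treeNodes.2 ?_))
    rw [hs]
    exact (lt_of_le_of_lt zero_le hξ').ne'

theorem rank_codedTree_eq_top {δ : Ordinal.{0}} {e : Tag → ℕ → Tag} (he : IsTagEnum δ e)
    {x : ℕ → ℕ} (hx : x ∈ genericReals) (s : List ℕ) (hs : tag e x s.reverse = ⊤) :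
    (codedTree he x).rank s = ⊤ := by
  rw [Tree.rank_eq_top_iff]
  intro hacc
  induction hacc with
  | intro s _ ih =>
    obtain ⟨k, hk⟩ := exists_tag_cons_eq he hx (u := s.reverse) (b := ⊤)
      ⟨Or.inr rfl, Or.inr (Or.inl ⟨hs, rfl⟩)⟩
    exact ih (s ++ [k]) ⟨append_mem_treeNodes.2 (by rw [hs]; exact WithTop.top_ne_zero), k, rfl⟩
      (by simpa using hk)

theorem tag_lt_or_eq_top {δ : Ordinal.{0}} {e : Tag → ℕ → Tag} (he : IsTagEnum δ e)
    (x : ℕ → ℕ) : ∀ u, tag e x u < δ ∨ tag e x u = ⊤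
  | [] => Or.inr rfl
  | k :: u => (legalTag_tag he x k u).1

theorem codedTree_mem_R {β : Ordinal.{0}} {e : Tag → ℕ → Tag} (he : IsTagEnum β e)
    {x : ℕ → ℕ} (hx : x ∈ genericReals) : codedTree he x ∈ R β := by
  refine ⟨isGood_codedTree he x, fun s _ => ?_⟩
  rcases tag_lt_or_eq_top he x s.reverse with h | h
  · right
    obtain ⟨b, hb⟩ := WithTop.ne_top_iff_exists.1 (h.trans_le le_top).ne
    rw [← hb] at h
    exact (rank_codedTree_lt_succ he x b s hb.symm).trans_le
      (WithTop.coe_le_coe.2 (Order.succ_le_of_lt (WithTop.coe_lt_coe.1 h)))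
  · exact Or.inl (rank_codedTree_eq_top he hx s h)

theorem codedTree_notMem_R {β : Ordinal.{0}} {e : Tag → ℕ → Tag}
    (he : IsTagEnum (Order.succ β) e) {x : ℕ → ℕ} (hx : x ∈ genericReals) {k : ℕ}
    (hk : tag e x [k] = β) : codedTree he x ∉ R β := by
  rintro ⟨-, h⟩
  have hmem : [k] ∈ (codedTree he x).nodes :=
    append_mem_treeNodes (s := []).2 WithTop.top_ne_zero
  rcases h [k] hmem with h | h
  · have := rank_codedTree_lt_succ he x β [k] hk
    rw [h] at this
    exact not_top_lt this
  · exact (le_rank_codedTree he hx β [k] hk (Order.le_succ β)).not_gt h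

/-! ### `R β` is not a small union. -/

/-- Below every condition there is one which can be retagged so that a child of the root gets the
tag `β`, without changing the tags less than `β`. -/
theorem exists_retag {β : Ordinal.{0}} (hβ : 0 < β) {e e' : Tag → ℕ → Tag} (he : IsTagEnum β e)
    (he' : IsTagEnum (Order.succ β) e') (x : ℕ → ℕ) (n : ℕ) :
    ∃ x₁ ∈ cylinder x n, ∃ x' : ℕ → ℕ, tag e' x' [n] = β ∧
      ∀ u, AgreeUpTo β (tag e x₁ u) (tag e' x' u) := by
  -- The child `[n]` is not yet decided by the first `n` values, so its tag is free.
  have hn : ¬ encode [n] < n := by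
    rw [encode_list_cons, not_lt]
    exact (Nat.left_le_pair n _).trans (Nat.le_succ _)
  let t : Tag → List ℕ → Tag := fun a u =>
    if encode u < n ∨ u = [] then tag e x u else if u = [n] then a else 0
  have ht0 : ∀ a, t a [] = ⊤ := fun a => by simp [t, tag]
  have ht1 : ∀ a u, encode u < n → t a u = tag e x u := fun a u hu => by simp [t, hu]
  have htn : ∀ a, t a [n] = a := fun a => by
    simp only [t, hn, false_or, reduceCtorEq, if_false, if_true]
  have hleg : ∀ (δ : Ordinal.{0}) (a : Tag), β ≤ δ → LegalTag δ ⊤ a →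
      ∀ u k, LegalTag δ (t a u) (t a (k :: u)) := by
    intro δ a hδ ha u k
    by_cases h1 : encode (k :: u) < n
    · rw [ht1 _ _ h1, ht1 _ _ ((encode_lt_encode_cons k u).trans h1)]
      have := legalTag_tag he x k u
      exact ⟨this.1.imp (·.trans_le (WithTop.coe_le_coe.2 hδ)) id, this.2⟩
    by_cases h2 : k :: u = [n]
    · rw [h2, htn]
      obtain ⟨rfl, rfl⟩ := List.cons.inj h2
      rw [ht0]
      exact ha
    · have : t a (k :: u) = 0 := by
        simp only [t, h1, h2, false_or, reduceCtorEq, if_false]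
      rw [this]
      exact legalTag_zero (hβ.trans_le hδ) _
  obtain ⟨x₁, hx₁, hx₁t⟩ := exists_tag_eq he (ht0 ⊤)
    (hleg β ⊤ le_rfl ⟨Or.inr rfl, Or.inr (Or.inl ⟨rfl, rfl⟩)⟩) (ht1 ⊤)
  obtain ⟨x', -, hx't⟩ := exists_tag_eq he' (x := x) (n := 0) (ht0 β)
    (hleg (Order.succ β) β (Order.le_succ β)
      ⟨Or.inl (WithTop.coe_lt_coe.2 (Order.lt_succ β)), Or.inl (WithTop.coe_lt_top β)⟩)
    (fun u hu => absurd hu (Nat.not_lt_zero _))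
  refine ⟨x₁, hx₁, x', by rw [hx't, htn], fun u => ?_⟩
  rw [hx't, hx₁t]
  by_cases h : u = [n]
  · rw [h, htn, htn]
    rintro (h | h)
    · exact absurd h not_top_lt
    · exact absurd h (lt_irrefl _)
  · intro _
    simp only [t, h, if_false]

/-- If fewer than `cov(meager)` many sets cover a comeagre set, then one of them is not meagre. -/
theorem exists_not_isMeagre {X : Type} {S : Set X} (hS : Cardinal.mk S < covMeager)
    {G : Set (ℕ → ℕ)} (hG : IsMeagre Gᶜ) {f : X → Set (ℕ → ℕ)}
    (hf : ∀ x ∈ G, ∃ A ∈ S, x ∈ f A) : ∃ A ∈ S, ¬ IsMeagre (f A) := by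
  by_contra! h
  have hne : S.Nonempty := by
    by_contra hne
    rw [not_nonempty_iff_eq_empty] at hne
    have : Gᶜ = univ := by
      refine eq_univ_of_forall fun x hx => ?_
      obtain ⟨A, hA, -⟩ := hf x hx
      rw [hne] at hA
      exact hA
    rw [this] at hG
    exact not_isMeagre_of_isOpen isOpen_univ univ_nonempty hG
  have hle : covMeager ≤ Cardinal.mk ((fun A => f A ∪ Gᶜ) '' S) := by
    refine csInf_le' ⟨_, ?_, ?_, rfl⟩
    · rintro _ ⟨A, hA, rfl⟩
      exact (h A hA).union hG
    · refine eq_univ_of_forall fun x => ?_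
      by_cases hx : x ∈ G
      · obtain ⟨A, hA, hxA⟩ := hf x hx
        exact ⟨_, ⟨A, hA, rfl⟩, Or.inl hxA⟩
      · obtain ⟨A, hA⟩ := hne
        exact ⟨_, ⟨A, hA, rfl⟩, Or.inr hx⟩
  exact (hle.trans Cardinal.mk_image_le).not_gt hS

theorem not_isSmallUnionOfPi_R {α β : Ordinal.{0}} (hα : 1 ≤ α) (hαβ : Ordinal.omega0 * α ≤ β)
    (hβ : β < Ordinal.omega 1) : ¬ IsSmallUnionOfPi α (R β) := by
  rintro ⟨S, hS, hpi, hU⟩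
  have h0 : 0 < β := (mul_pos Ordinal.omega0_pos (zero_lt_one.trans_le hα)).trans_le hαβ
  obtain ⟨e, he⟩ := exists_isTagEnum h0 hβ
  obtain ⟨e', he'⟩ := exists_isTagEnum (h0.trans (Order.lt_succ β))
    ((Cardinal.isSuccLimit_omega 1).succ_lt hβ)
  obtain ⟨A, hA, hmeagre⟩ := exists_not_isMeagre hS isMeagre_compl_genericReals
    (f := fun A => codedTree he ⁻¹' A) fun x hx => by
      have := codedTree_mem_R he hx
      rwa [← hU] at this
  have hmeas : @MeasurableSet _ (borel (ℕ → ℕ)) (codedTree he ⁻¹' A) := by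
    have := (IsSigma.preimage (continuous_codedTree he) (hpi A hA)).measurableSet
    rw [preimage_compl] at this
    exact this.of_compl
  obtain ⟨x, -, n, -, hx⟩ := exists_cylinder_diff_isMeagre isOpen_univ hmeas
    (by rwa [univ_inter])
  obtain ⟨x₁, hx₁, x', hx', hagr⟩ := exists_retag h0 he he' x n
  -- This length is just enough to decide the tag of `[n]`.
  have hsub : cylinder x₁ (encode [n] + 1) ⊆ cylinder x n := by
    rw [← mem_cylinder_iff_eq.1 hx₁]
    refine cylinder_anti _ ?_
    rw [encode_list_cons]
    exact ((Nat.left_le_pair n _).trans (Nat.le_succ _)).trans (Nat.le_succ _)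
  have hm' := IsSigma.isMeagre_retag (hpi A hA) he he' hαβ (hαβ.trans (Order.le_succ β))
    (x := x₁) (x' := x') (n := encode [n] + 1) (fun u _ => (hagr u).mono hαβ)
    (hx.mono (inter_subset_inter_left _ hsub))
  refine not_isMeagre_cylinder x' (encode [n] + 1)
    ((hm'.union isMeagre_compl_genericReals).mono fun y hy => ?_)
  by_cases hyG : y ∈ genericReals
  · have hyβ : tag e' y [n] = β := by rw [tag_congr e' hy _ (Nat.lt_succ_self _), hx']
    exact Or.inl ⟨hy, fun hyA => codedTree_notMem_R he' hyG hyβ (hU ▸ ⟨A, hA, hyA⟩)⟩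
  · exact Or.inr hyG

/-! ### Transfer to the Baire space. -/

/-- The largest tree contained in the set of finite sequences whose codes are not zeros of `x`. -/
def interiorTree (x : ℕ → ℕ) : Tree :=
  ⟨{s | ∀ t, t <+: s → x (encode t) ≠ 0}, fun s a h t ht => h t (ht.trans (s.prefix_append [a]))⟩

theorem continuous_interiorTree : Continuous interiorTree := by
  refine continuous_induced_rng.2 (continuous_pi fun s => ?_)
  rw [continuous_discrete_rng]
  intro b
  have hfin : {t | t <+: s}.Finite := by
    refine s.inits.toFinset.finite_toSet.subset fun t ht => ?_
    simpa using ht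
  have hT : IsClopen {x : ℕ → ℕ | ∀ t ∈ {t | t <+: s}, x (encode t) ≠ 0} := by
    rw [ofPred_forall]
    simp_rw [ofPred_forall]
    exact hfin.isClopen_biInter fun t _ =>
      (isClopen_discrete {0}ᶜ).preimage (continuous_apply (encode t))
  cases b
  · convert hT.compl.isOpen using 1
    ext x
    exact (Bool.not_eq_true _ ▸ Iff.rfl : _ ↔ ¬ (interiorTree x).indicator s = true).trans
      Tree.indicator_eq_true.not
  · convert hT.isOpen using 1
    ext x
    exact Tree.indicator_eq_true

/-- A real coding a tree. -/
noncomputable def codeOfTree (T : Tree) (i : ℕ) : ℕ :=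
  ((decode i : Option (List ℕ)).map fun s => (T.indicator s).toNat).getD 0

theorem continuous_codeOfTree : Continuous codeOfTree := by
  refine continuous_pi fun i => ?_
  unfold codeOfTree
  cases (decode i : Option (List ℕ)) with
  | none => exact continuous_const
  | some s =>
    exact (continuous_of_discreteTopology (f := Bool.toNat)).comp
      ((continuous_apply s).comp continuous_indicator)

theorem interiorTree_codeOfTree (T : Tree) : interiorTree (codeOfTree T) = T := by
  refine Subtype.ext (Set.ext fun s => ?_)
  have h : ∀ t, codeOfTree T (encode t) ≠ 0 ↔ t ∈ T.nodes := fun t => by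
    simp [codeOfTree, Tree.indicator]
  change (∀ t, t <+: s → codeOfTree T (encode t) ≠ 0) ↔ s ∈ T.nodes
  simp_rw [h]
  exact ⟨fun h => h s List.prefix_rfl, fun hs t ht => Descriptive.Tree.mem_of_prefix ht hs⟩

theorem IsSmallUnionOfPi.preimage {X Y : Type} [TopologicalSpace X] [TopologicalSpace Y]
    {f : X → Y} (hf : Continuous f) {α : Ordinal.{0}} {B : Set Y} (h : IsSmallUnionOfPi α B) :
    IsSmallUnionOfPi α (f ⁻¹' B) := by
  obtain ⟨S, hS, hpi, rfl⟩ := h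
  refine ⟨Set.preimage f '' S, Cardinal.mk_image_le.trans_lt hS, ?_, ?_⟩
  · rintro _ ⟨A, hA, rfl⟩
    exact IsSigma.preimage hf (hpi A hA)
  · rw [sUnion_image, sUnion_eq_biUnion, preimage_iUnion₂]

theorem omega0_mul_lt_omega_one {α : Ordinal.{0}} (hα : α < Ordinal.omega 1) :
    Ordinal.omega0 * α < Ordinal.omega 1 :=
  Ordinal.isPrincipal_mul_omega 1 Ordinal.omega0_lt_omega_one hα

end SternThm

theorem theorem2 :
    (∀ α : Ordinal.{0}, 1 ≤ α → α < Ordinal.omega 1 →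
      ∃ B : Set (ℕ → ℕ), @MeasurableSet (ℕ → ℕ) (borel (ℕ → ℕ)) B ∧ ¬ SternThm.IsSmallUnionOfPi α B) ∧
    (∀ α β : Ordinal.{0}, 1 ≤ α → Ordinal.omega0 * α ≤ β → β < Ordinal.omega 1 →
      @MeasurableSet SternThm.Tree (borel SternThm.Tree) (SternThm.R β) ∧
        ¬ SternThm.IsSmallUnionOfPi α (SternThm.R β)) := by
  refine ⟨fun α h1 hα => ?_, fun α β h1 hαβ hβ =>
    ⟨SternThm.measurableSet_R hβ, SternThm.not_isSmallUnionOfPi_R h1 hαβ hβ⟩⟩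
  have hω := SternThm.omega0_mul_lt_omega_one hα
  -- Pulling a small union back along the section `codeOfTree` would make `R (ω * α)` itself one.
  refine ⟨SternThm.interiorTree ⁻¹' SternThm.R (Ordinal.omega0 * α), ?_, fun h => ?_⟩
  · borelize (ℕ → ℕ)
    borelize SternThm.Tree
    exact SternThm.continuous_interiorTree.measurable (SternThm.measurableSet_R hω)
  · refine SternThm.not_isSmallUnionOfPi_R h1 le_rfl hω ?_
    have := h.preimage SternThm.continuous_codeOfTree
    rwa [← Set.preimage_comp, show SternThm.interiorTree ∘ SternThm.codeOfTree = id from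
      funext SternThm.interiorTree_codeOfTree, Set.preimage_id] at this
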